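/- Let $\mathbb F$ be a field, $n\ge 0$, and let $[n]=\{0\le 1\le\dots\le n\}$ with segments $\mathrm{Seg}([n])=\{(p,q): p\le q\}$. Let $\mathrm{Rep}([n])$ be the category of functors $[n]\to\mathrm{Vect}_{\mathbb F}$ with finite total rank, and let $\mathrm{Rk}\,V(p,q)=\operatorname{rank}(V(p)\to V(q))$. Let $K_0(\mathrm{Rep}([n])_{\mathrm{Rk}})$ be the Grothendieck group with generators $[V]$ and relations $[V]=[V']+[V'']$ for the short exact sequences $0\to V'\to V\to V''\to 0$ with $\mathrm{Rk}\,V=\mathrm{Rk}\,V'+\mathrm{Rk}\,V''$. Let $X([n])$ be the cubical one-manifold $[0,n]\subset\mathbb R$ with zero-strata $\{i\}$ ($0\le i\le n$) and one-strata $(i,i+1)$ ($0\le i<n$), let $\mathrm{Ent}_\Delta(X([n]))$ be the category of its strata with one morphism $\sigma\to\tau$ whenever $\tau$ is a face of $\sigma$ (i.e. $\tau\subseteq\overline{\sigma}$), and let $\mathrm{pMod}^{\mathrm{Vect}}(X([n]))$ be the category of functors from $\mathrm{Ent}_\Delta(X([n]))$ to finite-dimensional $\mathbb F$-vector spaces,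 with $K_0$ formed using all short exact sequences. Then: 1. The rank map $[V]\mapsto \mathrm{Rk}\,V$ is an isomorphism $K_0(\mathrm{Rep}([n])_{\mathrm{Rk}})\cong\mathbb Z^{\mathrm{Seg}([n])}$, and $|\mathrm{Seg}([n])|=\frac{(n+1)(n+2)}2$. 2. The dimension map $[M]\mapsto(\sigma\mapsto\dim M(\sigma))$ is an isomorphism from $K_0(\mathrm{pMod}^{\mathrm{Vect}}(X([n])))$ onto $\mathbb Z^{\{\text{strata of }X([n])\}}$, and $X([n])$ has $2n+1$ strata. 3. Sending a stratum to the set of vertices in its closure is an isomorphism, preserving and reflecting the face relation, from the strata of $X([n])$ onto the simplices of the spine of the $n$-simplex $\Delta^n$ (the subcomplex of the vertices $\{i\}$ and the edges $\{i,i+1\}$). The spine is a subcomplex of the 1-skeleton $\mathrm{sk}_1\Delta^n$ of the order complex of $[n]$, whose simplices correspond bijectively to $\mathrm{Seg}([n])$ by $(p,q)\mapsto\{p,q\}$. 4. The inclusion of the spine into $\mathrm{sk}_1\Delta^n$ induces a projection $$\pi\colon K_0(\mathrm{Rep}([n])_{\mathrm{Rk}})\cong\mathbb Z^{\frac{(n+1)(n+2)}2}\longrightarrow\mathbb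 Z^{2n+1}\cong K_0(\mathrm{pMod}^{\mathrm{Vect}}(X([n]))).$$ That is, there is a unique homomorphism $\pi$ that, under the isomorphisms in 1 and 2 and the identifications in 3, is the restriction of functions from the simplices of $\mathrm{sk}_1\Delta^n$ to those of the spine. This $\pi$ is surjective, and there is a homomorphism $s$ with $\pi\circ s=\mathrm{id}$. -/

import Mathlib

open CategoryTheory CategoryTheory.Limits

universe u v w

namespace PersistenceK

noncomputable section

/-! ### Grothendieck groups -/

section Grothendieck

variable {C : Type u} [Category.{v} C] [HasZeroMorphisms C]

/-- The relations `[X₂] - [X₁] - [X₃]`, one for each conflation `X₁ ⟶ X₂ ⟶ X₃`. -/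
def relations (E : ShortComplex C → Prop) : AddSubgroup (FreeAbelianGroup C) :=
  AddSubgroup.closure {x | ∃ S : ShortComplex C, E S ∧
    x = FreeAbelianGroup.of S.X₂ - FreeAbelianGroup.of S.X₁ - FreeAbelianGroup.of S.X₃}

/-- The group `K₀` of the category `C` with conflations `E`: generators `[X]` for the objects
`X` of `C`, relations `[X₂] = [X₁] + [X₃]` for the conflations `X₁ ⟶ X₂ ⟶ X₃`. -/
abbrev K0 (E : ShortComplex C → Prop) : Type u :=
  FreeAbelianGroup C ⧸ relations E

/-- The class `[X]` in `K₀`. -/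
def K0.mk (E : ShortComplex C → Prop) (X : C) : K0 E :=
  QuotientAddGroup.mk (FreeAbelianGroup.of X)

/-- The homomorphism out of `K₀` given by an additive invariant `f` of objects. -/
def K0.lift (E : ShortComplex C → Prop) {A : Type w} [AddCommGroup A] (f : C → A)
    (hf : ∀ S : ShortComplex C, E S → f S.X₂ = f S.X₁ + f S.X₃) : K0 E →+ A :=
  QuotientAddGroup.lift (relations E) (FreeAbelianGroup.lift f) <| by
    rw [relations, AddSubgroup.closure_le]
    rintro x ⟨S, hS, rfl⟩
    simp [hf S hS]

theorem K0.lift_mk (E : ShortComplex C → Prop) {A : Type w} [AddCommGroup A] (f : C → A)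
    (hf : ∀ S : ShortComplex C, E S → f S.X₂ = f S.X₁ + f S.X₃) (X : C) :
    K0.lift E f hf (K0.mk E X) = f X := by
  change FreeAbelianGroup.lift f (FreeAbelianGroup.of X) = f X
  simp

end Grothendieck

/-! ### Representations of posets with the rank-exact structure -/

section Rep

variable (K : Type u) [Field K] (P : Type w) [PartialOrder P]

/-- A functor `P ⥤ Vect` has finite total rank: all its values are finite dimensional (built into
`FGModuleCat K`) and all but finitely many of them are zero. -/
def finiteTotalRank : ObjectProperty (P ⥤ FGModuleCat.{u} K) :=
  fun V => {p : P | Nontrivial (V.obj p)}.Finite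

/-- The category `Rep(P)`. -/
abbrev Rep := (finiteTotalRank K P).FullSubcategory

/-- The segments of `P`. -/
abbrev Seg := {s : P × P // s.1 ≤ s.2}

variable {K P}

/-- The rank invariant of a functor: `(p, q) ↦ rank (V p ⟶ V q)`. -/
def rankInvariant (V : P ⥤ FGModuleCat.{u} K) (s : Seg P) : ℤ :=
  (Module.finrank K (LinearMap.range (V.map (homOfLE s.2)).hom.hom) : ℤ)

variable (K P)

/-- The rank-exact sequences of `Rep(P)`: short exact sequences (equivalently, pointwise short exact
sequences of functors) along which the rank invariant is additive. -/
def IsRankExact (S : ShortComplex (Rep K P)) : Prop :=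
  (S.map (finiteTotalRank K P).ι).ShortExact ∧
    rankInvariant S.X₂.obj = rankInvariant S.X₁.obj + rankInvariant S.X₃.obj

/-- The group `K₀(Rep(P)_Rk)`. -/
abbrev K0RepRk := K0 (IsRankExact K P)

/-- The rank map `K₀(Rep(P)_Rk) → ℤ^Seg(P)`, `[V] ↦ Rk V`. -/
def rankHom : K0RepRk K P →+ (Seg P → ℤ) :=
  K0.lift _ (fun V => rankInvariant V.obj) fun _ hS => hS.2

end Rep

/-! ### Simplicial complexes -/

section Complexes

/-- The order complex of a poset: its faces are the nonempty finite chains. -/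
def orderComplex (P : Type w) [PartialOrder P] : AbstractSimplicialComplex P where
  faces := {s | s.Nonempty ∧ IsChain (· ≤ ·) (s : Set P)}
  isRelLowerSet_faces := fun _ hs =>
    ⟨hs.1, fun _ hts ht => ⟨ht, hs.2.mono (Finset.coe_subset.2 hts)⟩⟩
  singleton_mem v := by simp

/-- The `d`-skeleton: the faces of dimension at most `d`, i.e. with at most `d + 1` vertices. -/
def skeleton {ι : Type w} (L : AbstractSimplicialComplex ι) (d : ℕ) :
    AbstractSimplicialComplex ι where
  faces := {s | s ∈ L ∧ s.card ≤ d + 1}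
  isRelLowerSet_faces := fun _ hs =>
    ⟨(L.isRelLowerSet_faces hs.1).1, fun _ hts ht =>
      ⟨(L.isRelLowerSet_faces hs.1).2 hts ht, (Finset.card_le_card hts).trans hs.2⟩⟩
  singleton_mem v := ⟨L.singleton_mem v, by simp⟩

/-- The bijection from segments to simplices of the 1-skeleton of the order complex:
`(p, q) ↦ {p, q}`. -/
def segToSkeleton (P : Type w) [PartialOrder P] [DecidableEq P] (s : Seg P) :
    {t : Finset P // t ∈ skeleton (orderComplex P) 1} :=
  ⟨{s.1.1, s.1.2}, ⟨⟨by simp, by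
    have h := s.2
    intro x hx y hy _
    simp only [Finset.coe_insert, Finset.coe_singleton, Set.mem_insert_iff,
      Set.mem_singleton_iff] at hx hy
    rcases hx with rfl | rfl <;> rcases hy with rfl | rfl <;> simp [h]⟩, Finset.card_le_two⟩⟩

theorem segToSkeleton_bijective (P : Type w) [PartialOrder P] [DecidableEq P] :
    Function.Bijective (segToSkeleton P) := by
  constructor
  · rintro ⟨⟨p, q⟩, h⟩ ⟨⟨p', q'⟩, h'⟩ e
    have e' : ({p, q} : Finset P) = {p', q'} := congrArg Subtype.val e
    have e'' : ({p, q} : Set P) = {p', q'} := by simpa using congrArg (fun t : Finset P => (t : Set P)) e'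
    dsimp only at h h'
    rcases Set.pair_eq_pair_iff.1 e'' with ⟨rfl, rfl⟩ | ⟨rfl, rfl⟩
    · rfl
    · obtain rfl := le_antisymm h h'
      rfl
  · rintro ⟨t, ⟨⟨x, hx⟩, hc⟩, hcard⟩
    have h2 : ∃ y ∈ t, t = {x, y} := by
      rcases Nat.lt_or_ge t.card 2 with h | h
      · have : t.card = 1 := by have := Finset.card_pos.2 ⟨x, hx⟩; omega
        obtain ⟨z, rfl⟩ := Finset.card_eq_one.1 this
        obtain rfl := Finset.mem_singleton.1 hx
        exact ⟨x, hx, by simp⟩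
      · obtain ⟨a, b, -, rfl⟩ := Finset.card_eq_two.1 (le_antisymm hcard h)
        rcases Finset.mem_insert.1 hx with rfl | hx
        · exact ⟨b, by simp, rfl⟩
        · obtain rfl := Finset.mem_singleton.1 hx
          exact ⟨a, by simp, Finset.pair_comm _ _⟩
    obtain ⟨y, hy, rfl⟩ := h2
    rcases hc.total hx hy with h | h
    · exact ⟨⟨(x, y), h⟩, rfl⟩
    · exact ⟨⟨(y, x), h⟩, Subtype.ext (Finset.pair_comm _ _)⟩

/-- Segments of `P` correspond to simplices of the 1-skeleton of the order complex. -/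
def segEquivSkeleton (P : Type w) [PartialOrder P] [DecidableEq P] :
    Seg P ≃ {t : Finset P // t ∈ skeleton (orderComplex P) 1} :=
  Equiv.ofBijective _ (segToSkeleton_bijective P)

/-- The spine of the `n`-simplex: its vertices and the edges joining consecutive vertices. -/
def spine (n : ℕ) : AbstractSimplicialComplex (Fin (n + 1)) where
  faces := {s | (∃ i : Fin (n + 1), s = {i}) ∨ ∃ i : Fin n, s = {i.castSucc, i.succ}}
  isRelLowerSet_faces := by
    rintro s (⟨i, rfl⟩ | ⟨i, rfl⟩)
    · refine ⟨by simp, fun t hts ht => Or.inl ⟨i, ?_⟩⟩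
      exact (Finset.Nonempty.subset_singleton_iff ht).1 hts
    · refine ⟨by simp, fun t hts ht => ?_⟩
      have h' : (t : Set (Fin (n + 1))) ⊆ {i.castSucc, i.succ} := by
        simpa using Finset.coe_subset.2 hts
      rcases Set.subset_pair_iff_eq.1 h' with h | h | h | h
      · exact absurd (Finset.coe_eq_empty.1 h) ht.ne_empty
      · exact Or.inl ⟨i.castSucc, Finset.coe_injective (by simpa using h)⟩
      · exact Or.inl ⟨i.succ, Finset.coe_injective (by simpa using h)⟩
      · exact Or.inr ⟨i, Finset.coe_injective (by simpa using h)⟩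
  singleton_mem v := Or.inl ⟨v, rfl⟩

/-- The spine is a subcomplex of the 1-skeleton of the `n`-simplex. -/
theorem spine_le (n : ℕ) : spine n ≤ skeleton (orderComplex (Fin (n + 1))) 1 := by
  rintro s (⟨i, rfl⟩ | ⟨i, rfl⟩)
  · exact ⟨⟨by simp, by simp⟩, by simp⟩
  · exact ⟨⟨by simp, fun x _ y _ _ => le_total x y⟩, Finset.card_le_two⟩

/-- The inclusion of the simplices of the spine into those of the 1-skeleton. -/
def spineInclusion (n : ℕ) (s : {t : Finset (Fin (n + 1)) // t ∈ spine n}) :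
    {t : Finset (Fin (n + 1)) // t ∈ skeleton (orderComplex (Fin (n + 1))) 1} :=
  ⟨s.1, spine_le n s.2⟩

end Complexes

/-! ### The cubical one-manifold of the linear order `[n]` and its persistence modules -/

section Cubical

/-- A stratum (open cube) of the cubical manifold `X([n])`, the interval `[0, n] ⊆ ℝ` cubulated by
the unit intervals `[i, i + 1]`: a zero-stratum `{i}` with `i ≤ n`, or a one-stratum `(i, i + 1)`
with `i < n`. -/
structure Stratum (n : ℕ) where
  carrier : Set ℝ
  isStratum : (∃ i : Fin (n + 1), carrier = {((i : ℕ) : ℝ)}) ∨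
    ∃ i : Fin n, carrier = Set.Ioo ((i : ℕ) : ℝ) ((i : ℕ) + 1)

/-- The face relation: `τ ≤ σ` if `τ` is a face of `σ`, i.e. is contained in the closure of `σ`. -/
instance (n : ℕ) : Preorder (Stratum n) where
  le τ σ := τ.carrier ⊆ closure σ.carrier
  le_refl _ := subset_closure
  le_trans _ _ _ h₁ h₂ := h₁.trans (closure_minimal h₂ isClosed_closure)

/-- The combinatorial entrance path category of `X([n])`: objects are the strata, and there is a
(unique) morphism `σ ⟶ τ` whenever `τ` is a face of `σ`. -/
abbrev Ent (n : ℕ) := (Stratum n)ᵒᵈ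

/-- The set of vertices of a stratum: the zero-strata in its closure. -/
def Stratum.vertices {n : ℕ} (σ : Stratum n) : Finset (Fin (n + 1)) :=
  open Classical in Finset.univ.filter fun i => ((i : ℕ) : ℝ) ∈ closure σ.carrier

theorem Stratum.vertices_mem_spine {n : ℕ} (σ : Stratum n) : σ.vertices ∈ spine n := by
  rcases σ with ⟨c, ⟨i, rfl⟩ | ⟨i, rfl⟩⟩
  · refine Or.inl ⟨i, ?_⟩
    ext j
    simp [Stratum.vertices, Fin.ext_iff]
  · refine Or.inr ⟨i, ?_⟩
    ext j
    have hne : ((i : ℕ) : ℝ) ≠ (i : ℕ) + 1 := by simp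
    simp only [Stratum.vertices, closure_Ioo hne, Finset.mem_filter, Finset.mem_univ, true_and,
      Set.mem_Icc, Finset.mem_insert, Finset.mem_singleton, Fin.ext_iff, Fin.val_castSucc,
      Fin.val_succ]
    norm_cast
    omega

/-- The identification of the strata of `X([n])` with the simplices of the spine. -/
def stratumToSpine (n : ℕ) (σ : Stratum n) : {t : Finset (Fin (n + 1)) // t ∈ spine n} :=
  ⟨σ.vertices, σ.vertices_mem_spine⟩

variable (K : Type u) [Field K]

/-- The category of persistence modules on `X([n])` with values in finite dimensional spaces. -/
abbrev PMod (n : ℕ) := Ent n ⥤ FGModuleCat.{u} K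

/-- The group `K₀(pMod(X([n])))`, defined by all short exact sequences. -/
abbrev K0PMod (n : ℕ) := K0 (fun S : ShortComplex (PMod K n) => S.ShortExact)

theorem finrank_additive {C : Type w} [Category.{v} C] (S : ShortComplex (C ⥤ FGModuleCat.{u} K))
    (hS : S.ShortExact) (c : C) :
    Module.finrank K (S.X₂.obj c) =
      Module.finrank K (S.X₁.obj c) + Module.finrank K (S.X₃.obj c) := by
  have h := (hS.map_of_exact ((evaluation C (FGModuleCat.{u} K)).obj c)).map_of_exact
    (forget₂ (FGModuleCat.{u} K) (ModuleCat.{u} K))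
  have : Module.Finite K ((S.map ((evaluation C (FGModuleCat.{u} K)).obj c)).map
      (forget₂ (FGModuleCat.{u} K) (ModuleCat.{u} K))).X₁ :=
    inferInstanceAs (Module.Finite K (S.X₁.obj c))
  have : Module.Finite K ((S.map ((evaluation C (FGModuleCat.{u} K)).obj c)).map
      (forget₂ (FGModuleCat.{u} K) (ModuleCat.{u} K))).X₃ :=
    inferInstanceAs (Module.Finite K (S.X₃.obj c))
  exact ModuleCat.free_shortExact_finrank_add h rfl rfl

/-- The dimension map `K₀(pMod(X([n]))) → ℤ^strata`, `[M] ↦ (σ ↦ dim M(σ))`. -/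
def dimHom (n : ℕ) : K0PMod K n →+ (Stratum n → ℤ) :=
  K0.lift _ (fun M σ => (Module.finrank K (M.obj (OrderDual.toDual σ)) : ℤ)) fun S hS => by
    funext σ
    simp [finrank_additive K S hS (OrderDual.toDual σ)]

/-- The map `ℤ^Seg([n]) → ℤ^strata` induced by the inclusion of the spine into the 1-skeleton:
restriction of functions along strata ≅ spine ⊆ 1-skeleton ≅ segments. -/
def spineRestriction (n : ℕ) : (Seg (Fin (n + 1)) → ℤ) →+ (Stratum n → ℤ) where
  toFun f σ := f ((segEquivSkeleton (Fin (n + 1))).symm (spineInclusion n (stratumToSpine n σ)))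
  map_zero' := rfl
  map_add' _ _ := rfl

end Cubical

end

end PersistenceK

/-!
Both isomorphisms are instances of one criterion, `bijective_of_span_eq_top`: a homomorphism
`A → ℤ^ι` is bijective as soon as some family in `A` indexed by `ι` generates `A` and its image
generates `ℤ^ι`. For the rank map the family consists of the interval modules, indexed by segments,
and for the dimension map of the simple modules, indexed by strata.

No decomposition into indecomposables is needed to see that these classes generate. A nonzero
functor `V` on a finite poset is divided by the submodule generated by a single vector `v ∈ V p`,
and the total dimension drops (`devissage`). Such a cyclic submodule is thin: it is isomorphic to
the functor that is constantly `K` on a convex set `D` and zero elsewhere, where `D` is the set of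
`b ≥ p` at which `v` survives (`cyclicHom`).

* On a linear order `D` is a closed interval. If `p` is the least point of the support of `V`, the
  cyclic submodule has surjective structure maps from every point where `V` is nonzero, and this
  makes the rank additive along the quotient sequence (`rankInvariant_cyclicSequence`). So the
  sequence is a relation of the rank-exact structure.
* On the strata, if `p` is maximal in the support of `V`, then `D = {p}` and the submodule is simple.

The dimension vectors of the simple modules are the standard basis. The rank invariant of the
interval module of `[p, q]` is the indicator function of the segments inside `[p, q]`, so these are
unitriangular with respect to inclusion (`span_indicator_segments_eq_top`).

The face relation is read off from vertices because closures of strata are convex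
(`Stratum.le_iff_vertices_subset`). Finally `π` is the restriction to the spine transported along
the two isomorphisms; it splits because the spine includes injectively into the 1-skeleton.
-/

namespace PersistenceK

/-! ### Generators of Grothendieck groups -/

section Generators

/-- A homomorphism `A →+ ℤ^ι` carrying a generating family of `A` indexed by `ι` to a generating
family of `ℤ^ι` is bijective: `ℤ^ι → A → ℤ^ι` is then a surjective endomorphism of a Noetherian
module, hence injective. -/
theorem bijective_of_span_eq_top {ι : Type*} [Finite ι] {A : Type*} [AddCommGroup A]
    (d : A →+ (ι → ℤ)) (c : ι → A) (hc : Submodule.span ℤ (Set.range c) = ⊤)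
    (hd : Submodule.span ℤ (Set.range fun i => d (c i)) = ⊤) : Function.Bijective d := by
  have := Fintype.ofFinite ι
  let g : (ι → ℤ) →ₗ[ℤ] A := Fintype.linearCombination ℤ c
  let e : A →ₗ[ℤ] (ι → ℤ) := d.toIntLinearMap
  have hg : Function.Surjective g := by
    rw [← LinearMap.range_eq_top, Fintype.range_linearCombination, hc]
  have heg : Function.Surjective (e ∘ₗ g) := by
    rw [← LinearMap.range_eq_top, LinearMap.range_comp, Fintype.range_linearCombination,
      Submodule.map_span, ← Set.range_comp]
    exact hd
  have hinj := OrzechProperty.injective_of_surjective_endomorphism _ heg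
  constructor
  · intro x y hxy
    obtain ⟨a, rfl⟩ := hg x
    obtain ⟨b, rfl⟩ := hg y
    exact congrArg g (hinj hxy)
  · intro y
    obtain ⟨a, ha⟩ := heg y
    exact ⟨g a, ha⟩

variable {C : Type u} [Category.{v} C] [HasZeroMorphisms C]

theorem K0.mk_eq_add (E : ShortComplex C → Prop) {S : ShortComplex C} (hS : E S) :
    K0.mk E S.X₂ = K0.mk E S.X₁ + K0.mk E S.X₃ := by
  have h : FreeAbelianGroup.of S.X₂ - FreeAbelianGroup.of S.X₁ - FreeAbelianGroup.of S.X₃ ∈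
      relations E := AddSubgroup.subset_closure ⟨S, hS, rfl⟩
  have h' := (QuotientAddGroup.eq_zero_iff _).2 h
  rw [sub_sub, QuotientAddGroup.mk_sub, sub_eq_zero] at h'
  exact h'

theorem K0.eq_top_of_mk_mem (E : ShortComplex C → Prop) (H : Submodule ℤ (K0 E))
    (h : ∀ X, K0.mk E X ∈ H) : H = ⊤ := by
  rw [Submodule.eq_top_iff']
  intro x
  obtain ⟨y, rfl⟩ := QuotientAddGroup.mk_surjective x
  induction y using FreeAbelianGroup.induction_on with
  | zero => exact H.zero_mem
  | of X => exact h X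
  | neg X hX => exact H.neg_mem hX
  | add a b ha hb => exact H.add_mem ha hb

/-- The class of `X` vanishes if `X → X → X` with zero maps is a conflation. -/
theorem K0.mk_eq_zero (E : ShortComplex C → Prop) (X : C)
    (h : E (ShortComplex.mk (0 : X ⟶ X) (0 : X ⟶ X) zero_comp)) : K0.mk E X = 0 := by
  simpa using K0.mk_eq_add E h

end Generators

theorem shortExact_of_isZero {A : Type*} [Category* A] [Abelian A] (S : ShortComplex A)
    (h₁ : IsZero S.X₁) (h₂ : IsZero S.X₂) (h₃ : IsZero S.X₃) : S.ShortExact :=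
  have : Mono S.f := ⟨fun _ _ _ => h₁.eq_of_tgt _ _⟩
  have : Epi S.g := ⟨fun _ _ _ => h₃.eq_of_src _ _⟩
  .mk (S.exact_of_isZero_X₂ h₂)

/-! ### Short exact sequences of functors to vector spaces -/

section Functors

variable {K : Type u} [Field K]

theorem isZero_iff_subsingleton {C : Type w} [Category.{v} C] (V : C ⥤ FGModuleCat.{u} K) :
    IsZero V ↔ ∀ p, Subsingleton (V.obj p) := by
  rw [Functor.isZero_iff]
  refine forall_congr' fun p => ⟨fun h => ?_, fun h => ?_⟩
  · refine ⟨fun x y => ?_⟩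
    have := congrArg (fun f : V.obj p ⟶ V.obj p => f.hom.hom) (h.eq_of_src (𝟙 _) 0)
    have h0 : ∀ z : V.obj p, z = 0 := fun z => LinearMap.congr_fun this z
    rw [h0 x, h0 y]
  · rw [IsZero.iff_id_eq_zero]
    ext x
    exact Subsingleton.elim _ _

/-- Short exactness of a sequence of functors, evaluated at one object. -/
theorem shortExact_app {C : Type w} [Category.{v} C] {S : ShortComplex (C ⥤ FGModuleCat.{u} K)}
    (hS : S.ShortExact) (c : C) :
    Function.Injective (S.f.app c).hom.hom ∧
      Function.Exact (S.f.app c).hom.hom (S.g.app c).hom.hom ∧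
      Function.Surjective (S.g.app c).hom.hom := by
  have h := (hS.map_of_exact ((evaluation C (FGModuleCat.{u} K)).obj c)).map_of_exact
    (forget₂ (FGModuleCat.{u} K) (ModuleCat.{u} K))
  exact ⟨h.moduleCat_injective_f,
    (ShortComplex.ShortExact.moduleCat_exact_iff_function_exact _).1 h.exact,
    h.moduleCat_surjective_g⟩

/-- Dévissage: a property of functors from a finite category to finite dimensional spaces holds for
all functors if it holds for the zero functors and every nonzero functor has a nonzero subfunctor
by which it may be divided. The induction is on the total dimension. -/
theorem devissage {C : Type w} [Category.{v} C] [Finite C]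
    {motive : (C ⥤ FGModuleCat.{u} K) → Prop} (zero : ∀ V, IsZero V → motive V)
    (step : ∀ V : C ⥤ FGModuleCat.{u} K, ¬ IsZero V → ∃ S : ShortComplex (C ⥤ FGModuleCat.{u} K),
      S.ShortExact ∧ S.X₂ = V ∧ ¬ IsZero S.X₁ ∧ (motive S.X₃ → motive V))
    (V : C ⥤ FGModuleCat.{u} K) : motive V := by
  have := Fintype.ofFinite C
  induction h : ∑ p, Module.finrank K (V.obj p) using Nat.strong_induction_on generalizing V with
  | _ N ih =>
    by_cases hV : IsZero V
    · exact zero V hV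
    · obtain ⟨S, hS, rfl, h1, hm⟩ := step V hV
      refine hm (ih _ ?_ S.X₃ rfl)
      rw [← h]
      rw [isZero_iff_subsingleton] at h1
      push Not at h1
      obtain ⟨p, hp⟩ := h1
      refine Finset.sum_lt_sum (fun q _ => ?_) ⟨p, Finset.mem_univ p, ?_⟩
      · rw [finrank_additive K S hS q]
        exact Nat.le_add_left _ _
      · rw [finrank_additive K S hS p]
        exact Nat.lt_add_of_pos_left Module.finrank_pos

/-- For a map of short exact sequences `0 → T → V → W → 0`, the rank is additive if every element
of `T'` that comes from `V` already comes from `T`. -/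
theorem finrank_range_eq_add {T V W T' V' W' : Type*}
    [AddCommGroup T] [Module K T] [AddCommGroup V] [Module K V] [AddCommGroup W] [Module K W]
    [AddCommGroup T'] [Module K T'] [AddCommGroup V'] [Module K V'] [AddCommGroup W'] [Module K W']
    [FiniteDimensional K V'] {g : V →ₗ[K] W} {f' : T' →ₗ[K] V'} {g' : V' →ₗ[K] W'}
    {t : T →ₗ[K] T'} {v : V →ₗ[K] V'} {w : W →ₗ[K] W'} {f : T →ₗ[K] V}
    (hf : f' ∘ₗ t = v ∘ₗ f) (hg : g' ∘ₗ v = w ∘ₗ g) (hf' : Function.Injective f')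
    (hex : Function.Exact f' g') (hsurj : Function.Surjective g)
    (h : ∀ x y, v x = f' y → y ∈ LinearMap.range t) :
    Module.finrank K (LinearMap.range v) =
      Module.finrank K (LinearMap.range t) + Module.finrank K (LinearMap.range w) := by
  have hk : LinearMap.ker (g'.domRestrict (LinearMap.range v)) =
      (LinearMap.range (f' ∘ₗ t)).comap (LinearMap.range v).subtype := by
    ext ⟨_, x, rfl⟩
    simp only [LinearMap.mem_ker, LinearMap.domRestrict_apply, Submodule.mem_comap,
      Submodule.subtype_apply]
    rw [hex (v x)]
    constructor
    · rintro ⟨y, hy⟩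
      obtain ⟨z, rfl⟩ := h x y hy.symm
      exact ⟨z, hy⟩
    · rintro ⟨z, hz⟩
      exact ⟨t z, hz⟩
  have hr : LinearMap.range (g'.domRestrict (LinearMap.range v)) = LinearMap.range w := by
    rw [LinearMap.range_domRestrict, ← LinearMap.range_comp, hg,
      LinearMap.range_comp_of_range_eq_top _ (LinearMap.range_eq_top.2 hsurj)]
  have hle : LinearMap.range (f' ∘ₗ t) ≤ LinearMap.range v := by
    rw [hf]
    exact LinearMap.range_comp_le_range _ _
  have := LinearMap.finrank_range_add_finrank_ker (g'.domRestrict (LinearMap.range v))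
  rw [hr, hk, (Submodule.comapSubtypeEquivOfLe hle).finrank_eq, LinearMap.range_comp,
    ← (Submodule.equivMapOfInjective f' hf' _).finrank_eq] at this
  omega

end Functors

/-! ### Thin modules and cyclic submodules -/

section Thin

variable (K : Type u) [Field K] {P : Type w}

open Classical in
/-- The value at `b` of the thin module with support `D`: the line `K` if `b ∈ D`, else zero. -/
noncomputable def thinStalk (D : Set P) (b : P) : Submodule K K := if b ∈ D then ⊤ else ⊥

theorem mem_thinStalk {D : Set P} {b : P} {x : K} : x ∈ thinStalk K D b ↔ b ∉ D → x = 0 := by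
  unfold thinStalk
  split_ifs with h <;> simp [h]

theorem finrank_thinStalk_of_mem {D : Set P} {b : P} (h : b ∈ D) :
    Module.finrank K (thinStalk K D b) = 1 := by
  rw [thinStalk, if_pos h, finrank_top, Module.finrank_self]

theorem finrank_thinStalk_of_notMem {D : Set P} {b : P} (h : b ∉ D) :
    Module.finrank K (thinStalk K D b) = 0 := by
  rw [thinStalk, if_neg h, finrank_bot]

open Classical in
/-- The structure map of a thin module: the identity of `K` between points of the support, and zero
otherwise. -/
noncomputable def thinMap (D : Set P) (a b : P) : thinStalk K D a →ₗ[K] thinStalk K D b :=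
  LinearMap.codRestrict _ ((if b ∈ D then (1 : K) else 0) • (thinStalk K D a).subtype) fun x => by
    rw [mem_thinStalk]
    intro h
    simp [h]

theorem thinMap_of_mem {D : Set P} {a b : P} (h : b ∈ D) (x : thinStalk K D a) :
    (thinMap K D a b x : K) = x := by
  simp [thinMap, h]

theorem thinMap_of_notMem {D : Set P} {a b : P} (h : b ∉ D) (x : thinStalk K D a) :
    (thinMap K D a b x : K) = 0 := by
  simp [thinMap, h]

variable [Preorder P]

/-- The thin module with support a convex set `D`: the functor that is `K` on `D`, with identity
structure maps, and zero elsewhere. For `D` an interval this is an interval module, for `D` a point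
a simple module. -/
noncomputable def thin (D : Set P) (hD : D.OrdConnected) : P ⥤ FGModuleCat.{u} K where
  obj b := FGModuleCat.of K (thinStalk K D b)
  map {a b} _ := FGModuleCat.ofHom (thinMap K D a b)
  map_id a := by
    ext x
    change (thinMap K D a a x : K) = x
    by_cases h : a ∈ D
    · exact thinMap_of_mem K h x
    · rw [thinMap_of_notMem K h, (mem_thinStalk K).1 x.2 h]
  map_comp {a b c} f g := by
    ext x
    change (thinMap K D a c x : K) = thinMap K D b c (thinMap K D a b x)
    by_cases hc : c ∈ D
    · rw [thinMap_of_mem K hc, thinMap_of_mem K hc]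
      by_cases hb : b ∈ D
      · rw [thinMap_of_mem K hb]
      · have ha : a ∉ D := fun ha => hb (hD.out ha hc ⟨leOfHom f, leOfHom g⟩)
        rw [thinMap_of_notMem K hb, (mem_thinStalk K).1 x.2 ha]
    · rw [thinMap_of_notMem K hc, thinMap_of_notMem K hc]

theorem thin_congr {D D' : Set P} (h : D = D') (hD : D.OrdConnected) (hD' : D'.OrdConnected) :
    thin K D hD = thin K D' hD' := by
  subst h
  rfl

variable {K}

/-- The support of the submodule of `V` generated by `v ∈ V p`. -/
def cyclicSupport (V : P ⥤ FGModuleCat.{u} K) (p : P) (v : V.obj p) : Set P :=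
  {b | ∃ h : p ≤ b, (V.map (homOfLE h)).hom.hom v ≠ 0}

theorem map_map_apply (V : P ⥤ FGModuleCat.{u} K) {a b c : P} (f : a ⟶ b) (g : b ⟶ c) (h : a ⟶ c)
    (x : V.obj a) : (V.map g).hom.hom ((V.map f).hom.hom x) = (V.map h).hom.hom x := by
  rw [Subsingleton.elim h (f ≫ g), V.map_comp]
  rfl

theorem mem_cyclicSupport_self (V : P ⥤ FGModuleCat.{u} K) (p : P) {v : V.obj p} (hv : v ≠ 0) :
    p ∈ cyclicSupport V p v := by
  refine ⟨le_rfl, ?_⟩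
  rw [Subsingleton.elim (homOfLE (le_refl p)) (𝟙 p), V.map_id]
  exact hv

theorem ordConnected_cyclicSupport (V : P ⥤ FGModuleCat.{u} K) (p : P) (v : V.obj p) :
    (cyclicSupport V p v).OrdConnected := by
  refine ⟨fun a ⟨ha, _⟩ c ⟨hc, hcv⟩ b ⟨hab, hbc⟩ => ⟨ha.trans hab, fun h0 => hcv ?_⟩⟩
  rw [← map_map_apply V (homOfLE (ha.trans hab)) (homOfLE hbc), h0, map_zero]

open Classical in
/-- The image of `v ∈ V p` in `V b`, taken to be zero unless `p ≤ b`. -/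
noncomputable def transport (V : P ⥤ FGModuleCat.{u} K) (p : P) (v : V.obj p) (b : P) : V.obj b :=
  if h : p ≤ b then (V.map (homOfLE h)).hom.hom v else 0

theorem transport_of_le (V : P ⥤ FGModuleCat.{u} K) {p b : P} (v : V.obj p) (h : p ≤ b) :
    transport V p v b = (V.map (homOfLE h)).hom.hom v :=
  dif_pos h

/-- The embedding of a thin module as the submodule of `V` generated by `v ∈ V p`. -/
noncomputable def cyclicHom (V : P ⥤ FGModuleCat.{u} K) (p : P) (v : V.obj p) :
    thin K (cyclicSupport V p v) (ordConnected_cyclicSupport V p v) ⟶ V where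
  app b := FGModuleCat.ofHom ((LinearMap.toSpanSingleton K (V.obj b) (transport V p v b)).comp
    (thinStalk K _ b).subtype)
  naturality a b f := by
    ext (x : thinStalk K (cyclicSupport V p v) a)
    change (thinMap K _ a b x : K) • transport V p v b =
      (V.map f).hom.hom ((x : K) • transport V p v a)
    by_cases ha : a ∈ cyclicSupport V p v
    · have hpb : p ≤ b := ha.1.trans (leOfHom f)
      rw [transport_of_le V v ha.1, transport_of_le V v hpb, map_smul,
        map_map_apply V _ f (homOfLE hpb)]
      by_cases hb : b ∈ cyclicSupport V p v
      · rw [thinMap_of_mem K hb]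
      · have : (V.map (homOfLE hpb)).hom.hom v = 0 := by
          by_contra h
          exact hb ⟨hpb, h⟩
        rw [this, smul_zero, smul_zero]
    · have hx : x = 0 := Subtype.ext ((mem_thinStalk K).1 x.2 ha)
      subst hx
      simp

instance (V : P ⥤ FGModuleCat.{u} K) (p : P) (v : V.obj p) : Mono (cyclicHom V p v) := by
  have (b : P) : Mono ((cyclicHom V p v).app b) := by
    refine ConcreteCategory.mono_of_injective _ ?_
    change Function.Injective ((LinearMap.toSpanSingleton K (V.obj b) (transport V p v b)).comp
      (thinStalk K (cyclicSupport V p v) b).subtype)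
    rw [injective_iff_map_eq_zero]
    intro x hx
    refine Subtype.ext ?_
    by_cases hb : b ∈ cyclicSupport V p v
    · have hx' : (x : K) • transport V p v b = 0 := hx
      rw [transport_of_le V v hb.1] at hx'
      exact (smul_eq_zero.1 hx').resolve_right hb.2
    · exact (mem_thinStalk K).1 x.2 hb
  exact NatTrans.mono_of_mono_app _

/-- The short exact sequence dividing `V` by the submodule generated by `v ∈ V p`. -/
noncomputable def cyclicSequence (V : P ⥤ FGModuleCat.{u} K) (p : P) (v : V.obj p) :
    ShortComplex (P ⥤ FGModuleCat.{u} K) :=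
  ShortComplex.mk (cyclicHom V p v) (cokernel.π (cyclicHom V p v)) (cokernel.condition _)

theorem shortExact_cyclicSequence (V : P ⥤ FGModuleCat.{u} K) (p : P) (v : V.obj p) :
    (cyclicSequence V p v).ShortExact :=
  have : Mono (cyclicSequence V p v).f := inferInstanceAs (Mono (cyclicHom V p v))
  have : Epi (cyclicSequence V p v).g := inferInstanceAs (Epi (cokernel.π (cyclicHom V p v)))
  .mk (ShortComplex.exact_cokernel _)

theorem not_isZero_thin {D : Set P} (hD : D.OrdConnected) (h : D.Nonempty) :
    ¬ IsZero (thin K D hD) := by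
  obtain ⟨p, hp⟩ := h
  rw [isZero_iff_subsingleton]
  intro h0
  have h1 : Module.finrank K (thinStalk K D p) = 0 :=
    have : Subsingleton (thinStalk K D p) := h0 p
    Module.finrank_zero_of_subsingleton
  rw [finrank_thinStalk_of_mem K hp] at h1
  exact one_ne_zero h1

end Thin

/-! ### The rank invariant on representations of a finite linear order -/

section LinearOrder

variable {K : Type u} [Field K]

theorem rankInvariant_thin {P : Type w} [PartialOrder P] {D : Set P} (hD : D.OrdConnected)
    (s : Seg P) [Decidable (s.1.1 ∈ D ∧ s.1.2 ∈ D)] :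
    rankInvariant (thin K D hD) s = if s.1.1 ∈ D ∧ s.1.2 ∈ D then 1 else 0 := by
  change (Module.finrank K (LinearMap.range (thinMap K D s.1.1 s.1.2)) : ℤ) = _
  by_cases h2 : s.1.2 ∈ D
  · by_cases h1 : s.1.1 ∈ D
    · have : LinearMap.range (thinMap K D s.1.1 s.1.2) = ⊤ := by
        refine LinearMap.range_eq_top.2 fun y => ?_
        refine ⟨⟨y, (mem_thinStalk K).2 fun h => absurd h1 h⟩, Subtype.ext ?_⟩
        rw [thinMap_of_mem K h2]
      rw [this, finrank_top, finrank_thinStalk_of_mem K h2, if_pos ⟨h1, h2⟩, Nat.cast_one]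
    · have : thinMap K D s.1.1 s.1.2 = 0 := by
        ext x
        rw [thinMap_of_mem K h2, (mem_thinStalk K).1 x.2 h1]
        rfl
      rw [this, LinearMap.range_zero, finrank_bot, if_neg fun h => h1 h.1, Nat.cast_zero]
  · have : thinMap K D s.1.1 s.1.2 = 0 := by
      ext x
      rw [thinMap_of_notMem K h2]
      rfl
    rw [this, LinearMap.range_zero, finrank_bot, if_neg fun h => h2 h.2, Nat.cast_zero]

/-- Dividing `V` by a cyclic submodule generated at a point below the whole support of `V` leaves
the rank invariant additive: such a submodule `T` has surjective structure maps from every point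
where `V` is nonzero. -/
theorem rankInvariant_cyclicSequence {P : Type w} [PartialOrder P] (V : P ⥤ FGModuleCat.{u} K)
    (p : P) (v : V.obj p) (hp : ∀ a, ¬ p ≤ a → Subsingleton (V.obj a)) :
    rankInvariant V = rankInvariant (cyclicSequence V p v).X₁ +
      rankInvariant (cyclicSequence V p v).X₃ := by
  have hS := shortExact_cyclicSequence V p v
  set S := cyclicSequence V p v
  ext ⟨⟨a, b⟩, hab⟩
  dsimp only at hab
  have hf : ((S.f.app b).hom.hom).comp (S.X₁.map (homOfLE hab)).hom.hom =
      ((S.X₂.map (homOfLE hab)).hom.hom).comp (S.f.app a).hom.hom :=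
    congrArg (fun φ => φ.hom.hom) (S.f.naturality (homOfLE hab))
  have hg : ((S.g.app b).hom.hom).comp (S.X₂.map (homOfLE hab)).hom.hom =
      ((S.X₃.map (homOfLE hab)).hom.hom).comp (S.g.app a).hom.hom :=
    congrArg (fun φ => φ.hom.hom) (S.g.naturality (homOfLE hab))
  have key := finrank_range_eq_add hf hg (shortExact_app hS b).1 (shortExact_app hS b).2.1
    (shortExact_app hS a).2.2 ?_
  · exact (congrArg (Nat.cast : ℕ → ℤ) key).trans (Nat.cast_add _ _)
  intro x y hxy
  by_cases hy : y = 0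
  · rw [hy]
    exact Submodule.zero_mem _
  -- now `V a` and the value of the cyclic submodule at `b` are nonzero
  have hpa : p ≤ a := by
    by_contra hpa
    have : Subsingleton (S.X₂.obj a) := hp a hpa
    rw [Subsingleton.elim x 0, map_zero] at hxy
    exact hy ((injective_iff_map_eq_zero _).1 (shortExact_app hS b).1 y hxy.symm)
  have hb : b ∈ cyclicSupport V p v := by
    by_contra hb
    exact hy (Subtype.ext ((mem_thinStalk K).1 (Subtype.prop (p := (· ∈ thinStalk K _ b)) y) hb))
  have hv : v ≠ 0 := by
    rintro rfl
    exact hb.2 (map_zero _)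
  have ha : a ∈ cyclicSupport V p v :=
    (ordConnected_cyclicSupport V p v).out (mem_cyclicSupport_self V p hv) hb ⟨hpa, hab⟩
  refine ⟨(⟨(y : thinStalk K (cyclicSupport V p v) b).1,
    (mem_thinStalk K).2 fun h => absurd ha h⟩ : thinStalk K (cyclicSupport V p v) a), ?_⟩
  exact Subtype.ext (thinMap_of_mem K hb _)

variable (K) {P : Type w} [LinearOrder P] [Finite P]

/-- A functor on a finite linear order as an object of `Rep(P)`: its total rank is finite. -/
def toRep (V : P ⥤ FGModuleCat.{u} K) : Rep K P := ⟨V, Set.toFinite _⟩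

/-- The interval module with support `[p, q]`. -/
noncomputable def intervalRep (s : Seg P) : Rep K P :=
  toRep K (thin K (Set.Icc s.1.1 s.1.2) Set.ordConnected_Icc)

/-- In a finite linear order the support of a cyclic module is a closed interval. -/
theorem exists_cyclicSupport_eq_Icc {K : Type u} [Field K] (V : P ⥤ FGModuleCat.{u} K) (p : P)
    {v : V.obj p} (hv : v ≠ 0) :
    ∃ s : Seg P, cyclicSupport V p v = Set.Icc s.1.1 s.1.2 := by
  obtain ⟨q, hq, hmax⟩ := Set.exists_max_image (cyclicSupport V p v) id (Set.toFinite _)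
    ⟨p, mem_cyclicSupport_self V p hv⟩
  refine ⟨⟨(p, q), hq.1⟩, Set.Subset.antisymm (fun b hb => ⟨hb.1, hmax b hb⟩) fun b hb => ?_⟩
  exact (ordConnected_cyclicSupport V p v).out (mem_cyclicSupport_self V p hv) hq hb

theorem span_intervalRep_eq_top :
    Submodule.span ℤ (Set.range fun s : Seg P =>
      K0.mk (IsRankExact K P) (intervalRep K s)) = ⊤ := by
  refine K0.eq_top_of_mk_mem _ _ fun V => ?_
  suffices h : ∀ V : P ⥤ FGModuleCat.{u} K, K0.mk (IsRankExact K P) (toRep K V) ∈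
      Submodule.span ℤ (Set.range fun s : Seg P => K0.mk (IsRankExact K P) (intervalRep K s)) from
    h V.obj
  intro V
  induction V using devissage with
  | zero V hV =>
    rw [K0.mk_eq_zero]
    · exact Submodule.zero_mem _
    · refine ⟨shortExact_of_isZero _ hV hV hV, ?_⟩
      ext s
      have := (isZero_iff_subsingleton V).1 hV s.1.2
      have h0 : rankInvariant V s = 0 :=
        Nat.cast_eq_zero.2 Module.finrank_zero_of_subsingleton
      change rankInvariant V s = rankInvariant V s + rankInvariant V s
      rw [h0, add_zero]
  | step V hV =>
    rw [isZero_iff_subsingleton] at hV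
    push Not at hV
    -- dividing by a vector at the least point of the support is a rank-exact operation
    obtain ⟨p, hp, hmin⟩ := Set.exists_min_image {p | Nontrivial (V.obj p)} id (Set.toFinite _) hV
    obtain ⟨v, hv⟩ := @exists_ne _ hp (0 : V.obj p)
    have hsub : ∀ a, ¬ p ≤ a → Subsingleton (V.obj a) := fun a ha =>
      not_nontrivial_iff_subsingleton.1 fun h => ha (hmin a h)
    have hS := shortExact_cyclicSequence V p v
    refine ⟨cyclicSequence V p v, hS, rfl,
      not_isZero_thin (ordConnected_cyclicSupport V p v) ⟨p, mem_cyclicSupport_self V p hv⟩,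
      fun h3 => ?_⟩
    obtain ⟨s, hs⟩ := exists_cyclicSupport_eq_Icc V p hv
    have h1 : toRep K (cyclicSequence V p v).X₁ = intervalRep K s :=
      congrArg (toRep K) (thin_congr K hs (ordConnected_cyclicSupport V p v) Set.ordConnected_Icc)
    let T : ShortComplex (Rep K P) :=
      ShortComplex.mk (X₁ := toRep K (cyclicSequence V p v).X₁) (X₂ := toRep K V)
        (X₃ := toRep K (cyclicSequence V p v).X₃) ⟨(cyclicSequence V p v).f⟩
        ⟨(cyclicSequence V p v).g⟩ (InducedCategory.hom_ext (cyclicSequence V p v).zero)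
    have hT : IsRankExact K P T := ⟨hS, rankInvariant_cyclicSequence V p v hsub⟩
    have hadd := K0.mk_eq_add _ hT
    change K0.mk _ (toRep K V) = K0.mk _ (toRep K (cyclicSequence V p v).X₁) +
      K0.mk _ (toRep K (cyclicSequence V p v).X₃) at hadd
    rw [hadd, h1]
    exact Submodule.add_mem _ (Submodule.subset_span ⟨s, rfl⟩) h3

/-- The indicator functions of the intervals of segments `{t | s.1 ≤ t.1, t.2 ≤ s.2}` generate
the group of integer functions on segments, being unitriangular with respect to inclusion. -/
theorem span_indicator_segments_eq_top :
    Submodule.span ℤ (Set.range fun s t : Seg P =>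
      if s.1.1 ≤ t.1.1 ∧ t.1.2 ≤ s.1.2 then (1 : ℤ) else 0) = ⊤ := by
  classical
  have := Fintype.ofFinite P
  set H := Submodule.span ℤ (Set.range fun s t : Seg P =>
      if s.1.1 ≤ t.1.1 ∧ t.1.2 ≤ s.1.2 then (1 : ℤ) else 0) with hH
  have hsingle : ∀ N : ℕ, ∀ s : Seg P, (Set.Icc s.1.1 s.1.2).ncard = N →
      (Pi.single s 1 : Seg P → ℤ) ∈ H := by
    intro N
    induction N using Nat.strong_induction_on with
    | _ N ih =>
      intro s hs
      have hsum : (Pi.single s 1 : Seg P → ℤ) =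
          (fun t : Seg P => if s.1.1 ≤ t.1.1 ∧ t.1.2 ≤ s.1.2 then (1 : ℤ) else 0) -
          ∑ t ∈ Finset.univ.filter fun t : Seg P =>
            (s.1.1 ≤ t.1.1 ∧ t.1.2 ≤ s.1.2) ∧ t ≠ s, Pi.single t 1 := by
        ext r
        simp only [Pi.sub_apply, Finset.sum_apply, Pi.single_apply, Finset.sum_ite_eq,
          Finset.mem_filter, Finset.mem_univ, true_and]
        by_cases hr : r = s
        · simp [hr]
        · simp [hr]
      rw [hsum]
      refine H.sub_mem (Submodule.subset_span ⟨s, rfl⟩) (H.sum_mem fun t ht => ?_)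
      obtain ⟨-, ⟨h1, h2⟩, hne⟩ := Finset.mem_filter.1 ht
      refine ih _ ?_ t rfl
      rw [← hs]
      refine Set.ncard_lt_ncard ⟨Set.Icc_subset_Icc h1 h2, fun hsub => hne ?_⟩ (Set.toFinite _)
      obtain ⟨h3, h4⟩ := (Set.Icc_subset_Icc_iff s.2).1 hsub
      exact Subtype.ext (Prod.ext (le_antisymm h3 h1) (le_antisymm h2 h4))
  rw [Submodule.eq_top_iff']
  intro f
  rw [pi_eq_sum_univ' f]
  refine H.sum_mem fun s _ => H.smul_mem _ ?_
  convert hsingle _ s rfl using 1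

theorem bijective_rankHom : Function.Bijective (rankHom K P) := by
  refine bijective_of_span_eq_top _ _ (span_intervalRep_eq_top K) ?_
  rw [← span_indicator_segments_eq_top]
  congr 2
  ext s t
  have h := rankInvariant_thin (K := K) (Set.ordConnected_Icc (a := s.1.1) (b := s.1.2)) t
  rw [rankHom, K0.lift_mk]
  refine h.trans (if_congr ⟨fun h => ⟨h.1.1, h.2.2⟩, fun h => ?_⟩ rfl rfl)
  exact ⟨⟨h.1, t.2.trans h.2⟩, h.1.trans t.2, h.2⟩

end LinearOrder

theorem card_seg (n : ℕ) : Nat.card (Seg (Fin (n + 1))) = (n + 1) * (n + 2) / 2 := by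
  rw [← Nat.card_congr (Sym2.sortEquiv (α := Fin (n + 1))), Nat.card_eq_fintype_card, Sym2.card,
    Fintype.card_fin, Nat.choose_two_right, mul_comm]
  rfl

/-! ### The strata of the interval and the spine -/

section Strata

variable {n : ℕ}

/-- The zero-stratum `{i}`. -/
def vertexStratum (i : Fin (n + 1)) : Stratum n := ⟨_, Or.inl ⟨i, rfl⟩⟩

/-- The one-stratum `(i, i + 1)`. -/
def edgeStratum (i : Fin n) : Stratum n := ⟨_, Or.inr ⟨i, rfl⟩⟩

theorem Stratum.eq_vertexStratum_or_eq_edgeStratum (σ : Stratum n) :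
    (∃ i, σ = vertexStratum i) ∨ ∃ i, σ = edgeStratum i := by
  rcases σ with ⟨c, ⟨i, rfl⟩ | ⟨i, rfl⟩⟩
  · exact Or.inl ⟨i, rfl⟩
  · exact Or.inr ⟨i, rfl⟩

theorem vertices_vertexStratum (i : Fin (n + 1)) :
    (vertexStratum i).vertices = {i} := by
  ext j
  simp [Stratum.vertices, vertexStratum, Fin.ext_iff]

theorem vertices_edgeStratum (i : Fin n) :
    (edgeStratum i).vertices = {i.castSucc, i.succ} := by
  ext j
  have hne : ((i : ℕ) : ℝ) ≠ (i : ℕ) + 1 := by simp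
  simp only [Stratum.vertices, edgeStratum, closure_Ioo hne, Finset.mem_filter, Finset.mem_univ,
    true_and, Set.mem_Icc, Finset.mem_insert, Finset.mem_singleton, Fin.ext_iff, Fin.val_castSucc,
    Fin.val_succ]
  norm_cast
  omega

theorem Stratum.mem_vertices {σ : Stratum n} {i : Fin (n + 1)} :
    i ∈ σ.vertices ↔ ((i : ℕ) : ℝ) ∈ closure σ.carrier := by
  simp [Stratum.vertices]

theorem Stratum.ordConnected_closure (σ : Stratum n) : (closure σ.carrier).OrdConnected := by
  obtain ⟨i, rfl⟩ | ⟨i, rfl⟩ := σ.eq_vertexStratum_or_eq_edgeStratum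
  · rw [vertexStratum, closure_singleton]
    exact Set.ordConnected_singleton
  · have hne : ((i : ℕ) : ℝ) ≠ (i : ℕ) + 1 := by simp
    rw [edgeStratum, closure_Ioo hne]
    exact Set.ordConnected_Icc

theorem Stratum.le_iff_vertices_subset (τ σ : Stratum n) : τ ≤ σ ↔ τ.vertices ⊆ σ.vertices := by
  constructor
  · intro h i hi
    rw [mem_vertices] at hi ⊢
    exact closure_minimal h isClosed_closure hi
  · intro h
    change τ.carrier ⊆ closure σ.carrier
    obtain ⟨i, rfl⟩ | ⟨i, rfl⟩ := τ.eq_vertexStratum_or_eq_edgeStratum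
    · rw [vertices_vertexStratum, Finset.singleton_subset_iff, mem_vertices] at h
      exact Set.singleton_subset_iff.2 h
    · rw [vertices_edgeStratum, Finset.insert_subset_iff, Finset.singleton_subset_iff,
        mem_vertices, mem_vertices] at h
      have h2 : ((i : ℕ) : ℝ) + 1 ∈ closure σ.carrier := by simpa using h.2
      exact Set.Ioo_subset_Icc_self.trans (σ.ordConnected_closure.out h.1 h2)

theorem eq_of_pair_castSucc_succ_eq {i j : Fin n}
    (h : ({i.castSucc, i.succ} : Finset (Fin (n + 1))) = {j.castSucc, j.succ}) : i = j := by
  have h1 := (Finset.ext_iff.1 h i.castSucc).1 (by simp)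
  have h2 := (Finset.ext_iff.1 h i.succ).1 (by simp)
  simp only [Finset.mem_insert, Finset.mem_singleton, Fin.ext_iff, Fin.val_castSucc,
    Fin.val_succ] at h1 h2
  exact Fin.ext (by omega)

theorem Stratum.vertices_injective : Function.Injective (Stratum.vertices (n := n)) := by
  intro σ τ h
  obtain ⟨i, rfl⟩ | ⟨i, rfl⟩ := σ.eq_vertexStratum_or_eq_edgeStratum <;>
  obtain ⟨j, rfl⟩ | ⟨j, rfl⟩ := τ.eq_vertexStratum_or_eq_edgeStratum <;>
  simp only [vertices_vertexStratum, vertices_edgeStratum] at h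
  · rw [Finset.singleton_injective h]
  · have h1 := (Finset.ext_iff.1 h j.castSucc).2 (by simp)
    have h2 := (Finset.ext_iff.1 h j.succ).2 (by simp)
    simp only [Finset.mem_singleton, Fin.ext_iff, Fin.val_castSucc, Fin.val_succ] at h1 h2
    omega
  · have h1 := (Finset.ext_iff.1 h i.castSucc).1 (by simp)
    have h2 := (Finset.ext_iff.1 h i.succ).1 (by simp)
    simp only [Finset.mem_singleton, Fin.ext_iff, Fin.val_castSucc, Fin.val_succ] at h1 h2
    omega
  · rw [eq_of_pair_castSucc_succ_eq h]

theorem stratumToSpine_bijective (n : ℕ) : Function.Bijective (stratumToSpine n) := by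
  refine ⟨fun σ τ h => Stratum.vertices_injective (congrArg Subtype.val h), ?_⟩
  rintro ⟨t, ⟨i, rfl⟩ | ⟨i, rfl⟩⟩
  · exact ⟨vertexStratum i, Subtype.ext (vertices_vertexStratum i)⟩
  · exact ⟨edgeStratum i, Subtype.ext (vertices_edgeStratum i)⟩

theorem Stratum.le_antisymm {σ τ : Stratum n} (h : σ ≤ τ) (h' : τ ≤ σ) : σ = τ :=
  Stratum.vertices_injective (Finset.Subset.antisymm ((Stratum.le_iff_vertices_subset _ _).1 h)
    ((Stratum.le_iff_vertices_subset _ _).1 h'))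

theorem sumElim_strata_bijective :
    Function.Bijective (Sum.elim vertexStratum edgeStratum : Fin (n + 1) ⊕ Fin n → Stratum n) := by
  constructor
  · have hv : Function.Injective (vertexStratum (n := n)) := fun i j h =>
      Finset.singleton_injective <| by
        rw [← vertices_vertexStratum, ← vertices_vertexStratum, h]
    have hcard : ∀ i : Fin n, (edgeStratum i).vertices.card = 2 := fun i => by
      rw [vertices_edgeStratum, Finset.card_pair (Fin.castSucc_lt_succ (i := i)).ne]
    refine hv.sumElim (fun i j h => ?_) fun i j h => ?_
    · have hij := congrArg Stratum.vertices h
      rw [vertices_edgeStratum, vertices_edgeStratum] at hij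
      exact eq_of_pair_castSucc_succ_eq hij
    · have h1 := hcard j
      rw [← h, vertices_vertexStratum, Finset.card_singleton] at h1
      exact absurd h1 (by decide)
  · intro σ
    obtain ⟨i, rfl⟩ | ⟨i, rfl⟩ := σ.eq_vertexStratum_or_eq_edgeStratum
    · exact ⟨Sum.inl i, rfl⟩
    · exact ⟨Sum.inr i, rfl⟩

theorem card_stratum (n : ℕ) : Nat.card (Stratum n) = 2 * n + 1 := by
  rw [← Nat.card_congr (Equiv.ofBijective _ (sumElim_strata_bijective (n := n)))]
  simp
  omega

instance : Finite (Stratum n) :=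
  Finite.of_surjective _ (sumElim_strata_bijective (n := n)).2

instance : Finite (Ent n) := inferInstanceAs (Finite (Stratum n))

end Strata

/-! ### Persistence modules on the strata -/

section PersistenceModules

variable (K : Type u) [Field K] {n : ℕ}

theorem ordConnected_singleton_ent (σ : Ent n) : ({σ} : Set (Ent n)).OrdConnected := by
  refine ⟨fun a ha c hc b hb => ?_⟩
  obtain rfl := Set.mem_singleton_iff.1 ha
  obtain rfl := Set.mem_singleton_iff.1 hc
  exact Stratum.le_antisymm (n := n) hb.1 hb.2

/-- The simple persistence module, one-dimensional at the stratum `σ` and zero elsewhere. -/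
noncomputable def simplePMod (σ : Stratum n) : PMod K n :=
  thin K {OrderDual.toDual σ} (ordConnected_singleton_ent _)

theorem span_simplePMod_eq_top :
    Submodule.span ℤ (Set.range fun σ : Stratum n =>
      K0.mk (fun S : ShortComplex (PMod K n) => S.ShortExact) (simplePMod K σ)) = ⊤ := by
  refine K0.eq_top_of_mk_mem _ _ fun V => ?_
  induction V using devissage with
  | zero V hV =>
    rw [K0.mk_eq_zero]
    · exact Submodule.zero_mem _
    · exact shortExact_of_isZero _ hV hV hV
  | step V hV =>
    rw [isZero_iff_subsingleton] at hV
    push Not at hV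
    -- at a maximal point `p` of the support of `V`, every line in `V p` is a simple submodule
    obtain ⟨p, hp⟩ := (Set.toFinite {p | Nontrivial (V.obj p)}).exists_maximal hV
    obtain ⟨v, hv⟩ := @exists_ne _ hp.1 (0 : V.obj p)
    have hS := shortExact_cyclicSequence V p v
    refine ⟨cyclicSequence V p v, hS, rfl,
      not_isZero_thin (ordConnected_cyclicSupport V p v) ⟨p, mem_cyclicSupport_self V p hv⟩,
      fun h3 => ?_⟩
    have hsupp : cyclicSupport V p v = {p} := by
      refine Set.Subset.antisymm (fun b hb => ?_)
        (Set.singleton_subset_iff.2 (mem_cyclicSupport_self V p hv))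
      have hpb := hb.1
      exact Stratum.le_antisymm (n := n) hpb (hp.2 ⟨_, _, hb.2⟩ hpb)
    have h1 : (cyclicSequence V p v).X₁ = simplePMod K (OrderDual.ofDual p) :=
      thin_congr K hsupp (ordConnected_cyclicSupport V p v) (ordConnected_singleton_ent p)
    have hadd := K0.mk_eq_add (fun S : ShortComplex (PMod K n) => S.ShortExact) hS
    change K0.mk _ V = _ at hadd
    rw [hadd, h1]
    exact Submodule.add_mem _ (Submodule.subset_span ⟨_, rfl⟩) h3

theorem bijective_dimHom (n : ℕ) : Function.Bijective (dimHom K n) := by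
  classical
  refine bijective_of_span_eq_top _ _ (span_simplePMod_eq_top K) ?_
  have := Fintype.ofFinite (Stratum n)
  rw [← (Pi.basisFun ℤ (Stratum n)).span_eq]
  congr 2
  ext σ τ
  rw [dimHom, K0.lift_mk, Pi.basisFun_apply, Pi.single_apply]
  change (Module.finrank K (thinStalk K _ _) : ℤ) = _
  by_cases h : τ = σ
  · rw [if_pos h, finrank_thinStalk_of_mem K (by simp [h]), Nat.cast_one]
  · rw [if_neg h, finrank_thinStalk_of_notMem K (by simpa using h), Nat.cast_zero]

end PersistenceModules

/-! ### The projection -/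

/-- The segment corresponding to a stratum through the inclusion of the spine into the
1-skeleton. -/
noncomputable def stratumToSeg (n : ℕ) (σ : Stratum n) : Seg (Fin (n + 1)) :=
  (segEquivSkeleton (Fin (n + 1))).symm (spineInclusion n (stratumToSpine n σ))

theorem stratumToSeg_injective (n : ℕ) : Function.Injective (stratumToSeg n) := by
  intro σ τ h
  have h' := congrArg Subtype.val ((segEquivSkeleton (Fin (n + 1))).symm.injective h)
  exact Stratum.vertices_injective h'

/-- Precomposition with a retraction of segments onto strata splits the restriction to the
spine. -/
theorem exists_section_spineRestriction (n : ℕ) :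
    ∃ e : (Stratum n → ℤ) →+ (Seg (Fin (n + 1)) → ℤ), ∀ f, spineRestriction n (e f) = f := by
  have : Nonempty (Stratum n) := ⟨vertexStratum 0⟩
  refine ⟨(LinearMap.funLeft ℤ ℤ (Function.invFun (stratumToSeg n))).toAddMonoidHom,
    fun f => funext fun σ => ?_⟩
  exact congrArg f (Function.leftInverse_invFun (stratumToSeg_injective n) σ)

end PersistenceK

theorem mainTheorem5 (K : Type u) [Field K] (n : ℕ) :
    -- the rank map is an isomorphism onto the functions on segments
    Function.Bijective (PersistenceK.rankHom K (Fin (n + 1))) ∧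
    Nat.card (PersistenceK.Seg (Fin (n + 1))) = (n + 1) * (n + 2) / 2 ∧
    -- the dimension map is an isomorphism onto the functions on strata
    Function.Bijective (PersistenceK.dimHom K n) ∧
    Nat.card (PersistenceK.Stratum n) = 2 * n + 1 ∧
    -- the cubical manifold is the spine, as a stratified space
    Function.Bijective (PersistenceK.stratumToSpine n) ∧
    (∀ τ σ : PersistenceK.Stratum n, τ ≤ σ ↔
      (PersistenceK.stratumToSpine n τ).1 ⊆ (PersistenceK.stratumToSpine n σ).1) ∧
    -- the homomorphism induced by the inclusion of the spine is a projection
    ∃ π : PersistenceK.K0RepRk K (Fin (n + 1)) →+ PersistenceK.K0PMod K n,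
      (∀ x, PersistenceK.dimHom K n (π x) =
        PersistenceK.spineRestriction n (PersistenceK.rankHom K (Fin (n + 1)) x)) ∧
      (∀ π' : PersistenceK.K0RepRk K (Fin (n + 1)) →+ PersistenceK.K0PMod K n,
        (∀ x, PersistenceK.dimHom K n (π' x) =
          PersistenceK.spineRestriction n (PersistenceK.rankHom K (Fin (n + 1)) x)) → π' = π) ∧
      Function.Surjective π ∧
      ∃ s : PersistenceK.K0PMod K n →+ PersistenceK.K0RepRk K (Fin (n + 1)),
        π.comp s = AddMonoidHom.id _ := by
  have hr := PersistenceK.bijective_rankHom K (P := Fin (n + 1))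
  have hd := PersistenceK.bijective_dimHom K n
  refine ⟨hr, PersistenceK.card_seg n, hd, PersistenceK.card_stratum n,
    PersistenceK.stratumToSpine_bijective n,
    fun τ σ => PersistenceK.Stratum.le_iff_vertices_subset τ σ, ?_⟩
  let R := AddEquiv.ofBijective (PersistenceK.rankHom K (Fin (n + 1))) hr
  let D := AddEquiv.ofBijective (PersistenceK.dimHom K n) hd
  let ρ := PersistenceK.spineRestriction n
  obtain ⟨e, he⟩ := PersistenceK.exists_section_spineRestriction n
  let π := (D.symm.toAddMonoidHom.comp ρ).comp R.toAddMonoidHom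
  let s := (R.symm.toAddMonoidHom.comp e).comp D.toAddMonoidHom
  have hπ : ∀ x, PersistenceK.dimHom K n (π x) =
      PersistenceK.spineRestriction n (PersistenceK.rankHom K (Fin (n + 1)) x) :=
    fun x => D.apply_symm_apply (ρ (R x))
  have hs : ∀ y, π (s y) = y := fun y => by
    change D.symm (ρ (R (R.symm (e (D y))))) = y
    rw [R.apply_symm_apply, he, D.symm_apply_apply]
  refine ⟨π, hπ, fun π' h' => ?_, fun y => ⟨s y, hs y⟩, s, AddMonoidHom.ext hs⟩
  ext x
  exact hd.1 ((h' _).trans (hπ _).symm)
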